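/- Let $k$ be an algebraically closed field of characteristic $p > 0$ and let $G$ be a semisimple (smooth, connected, affine) algebraic group over $k$ with Lie algebra $\mathfrak{g}$. For a finite-dimensional representation $V$ of $G$, say that $\mathfrak{g}$ acts virtually freely on $V$ if there is a dense Zariski-open subset $U \subseteq V$ such that for every $v \in U$ the stabilizer $\mathfrak{g}_v = \{x \in \mathfrak{g} : xv = 0\}$ equals $\ker[\mathfrak{g} \to \mathfrak{gl}(V)]$. For a finite-dimensional representation $W$ of $G$, with dual $W^*$, write $W^{[p]^i}$ for its $i$-th Frobenius twist (the representation whose matrix coefficients are the $p^i$-th powers of those of $W$). Then for every finite-dimensional representation $W$ of $G$ and every integer $i > 0$, $\mathfrak{g}$ acts virtually freely on $W \otimes W^{[p]^i}$ and on $W \otimes (W^*)^{[p]^i}$. -/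

import Mathlib

open scoped TensorProduct

noncomputable section

namespace AlgGrp

open TensorProduct Coalgebra

attribute [local instance] LieRing.ofAssociativeRing

/-! An affine group scheme `G` over a field `k` is given by its commutative Hopf algebra of regular
functions `A = k[G]`; thus `G(R)` is the set of `k`-algebra maps `A → R`. -/

/-- The Zariski topology on a set `X` for a `k`-algebra `F` of `k`-valued functions on `X`: the
sets `{x | f x ≠ 0}` with `f ∈ F` form a basis of open sets. -/
@[reducible] def zariski {k X : Type*} [Field k] (F : Subalgebra k (X → k)) : TopologicalSpace X :=
  TopologicalSpace.generateFrom {U | ∃ f ∈ F, U = {x | f x ≠ 0}}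

/-- The group `G(k)` of rational points; its multiplication is the convolution of Mathlib,
`(g * h)(a) = ∑ g(a₁) h(a₂)`. -/
abbrev Points (k A : Type*) [Field k] [CommRing A] [HopfAlgebra k A] : Type _ :=
  WithConv (A →ₐ[k] k)

/-- A regular function as a function on the rational points. -/
def evalPoints (k A : Type*) [Field k] [CommRing A] [HopfAlgebra k A] :
    A →ₐ[k] (Points k A → k) where
  toFun a g := g.ofConv a
  map_one' := by ext g; simp
  map_mul' a b := by ext g; simp
  map_zero' := by ext g; simp
  map_add' a b := by ext g; simp
  commutes' c := by ext g; simp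

/-- The Zariski topology on `G(k)`. -/
@[reducible] def pointsTopology (k A : Type*) [Field k] [CommRing A] [HopfAlgebra k A] :
    TopologicalSpace (Points k A) :=
  zariski (evalPoints k A).range

/-- `G = Spec A` is a semisimple algebraic group over the algebraically closed field `k`: it is
smooth (in particular of finite type) and connected, and its radical is trivial, that is, the
only closed connected solvable normal subgroup of `G(k)` is the trivial one. (As `k` is
algebraically closed, the Zariski-closed subgroups of `G(k)` are the smooth closed subgroup
schemes of `G`.) -/
structure IsSemisimple (k A : Type*) [Field k] [IsAlgClosed k] [CommRing A] [HopfAlgebra k A] :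
    Prop where
  smooth : Algebra.Smooth k A
  connected : ConnectedSpace (PrimeSpectrum A)
  radical_eq_bot : ∀ N : Subgroup (Points k A), N.Normal →
    @IsClosed _ (pointsTopology k A) (N : Set (Points k A)) →
    @IsConnected _ (pointsTopology k A) (N : Set (Points k A)) →
    Group.IsSolvable N → N = ⊥

section Lie

variable (k A : Type*) [Field k] [CommRing A] [HopfAlgebra k A]

/-- The Lie algebra `𝔤 = Lie(G)`: the point derivations `A → k` at the identity element (the
counit), a Lie subalgebra of the distribution algebra, i.e. of the `k`-dual of `A` with the
convolution product, under the commutator bracket. -/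
def Lie : LieSubalgebra k (WithConv (A →ₗ[k] k)) where
  carrier := {x | ∀ a b : A, x.ofConv (a * b) =
    counit (R := k) a * x.ofConv b + counit (R := k) b * x.ofConv a}
  zero_mem' a b := by simp
  add_mem' {x y} hx hy a b := by
    simp only [Set.mem_ofPred_eq] at hx hy
    simp only [WithConv.ofConv_add, LinearMap.add_apply, hx a b, hy a b]; ring
  smul_mem' c x hx a b := by
    simp only [Set.mem_ofPred_eq] at hx
    simp only [WithConv.ofConv_smul, LinearMap.smul_apply, hx a b, smul_eq_mul]; ring
  lie_mem' {x y} hx hy a b := by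
    have key : ∀ {x y : WithConv (A →ₗ[k] k)},
        (∀ a b : A, x.ofConv (a * b) =
          counit (R := k) a * x.ofConv b + counit (R := k) b * x.ofConv a) →
        (∀ a b : A, y.ofConv (a * b) =
          counit (R := k) a * y.ofConv b + counit (R := k) b * y.ofConv a) →
        (x * y).ofConv (a * b) = counit (R := k) a * (x * y).ofConv b
          + x.ofConv b * y.ofConv a + x.ofConv a * y.ofConv b
          + counit (R := k) b * (x * y).ofConv a := by
      intro x y hx hy
      have h : ∀ s t : A ⊗[k] A,
          LinearMap.mul' k k (map x.ofConv y.ofConv (s * t)) =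
            counit (R := k) (TensorProduct.lid k A (counit.rTensor A s)) *
                LinearMap.mul' k k (map x.ofConv y.ofConv t) +
            x.ofConv (TensorProduct.rid k A (counit.lTensor A t)) *
                y.ofConv (TensorProduct.lid k A (counit.rTensor A s)) +
            x.ofConv (TensorProduct.rid k A (counit.lTensor A s)) *
                y.ofConv (TensorProduct.lid k A (counit.rTensor A t)) +
            counit (R := k) (TensorProduct.lid k A (counit.rTensor A t)) *
                LinearMap.mul' k k (map x.ofConv y.ofConv s) := by
        intro s t
        induction s with
        | zero => simp
        | add s₁ s₂ h₁ h₂ => simp only [add_mul, map_add, h₁, h₂]; ring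
        | tmul a₁ a₂ =>
          induction t with
          | zero => simp
          | add t₁ t₂ h₁ h₂ => simp only [mul_add, map_add, h₁, h₂]; ring
          | tmul b₁ b₂ =>
            simp only [Algebra.TensorProduct.tmul_mul_tmul, map_tmul, LinearMap.mul'_apply, hx, hy,
              LinearMap.rTensor_tmul, LinearMap.lTensor_tmul, lid_tmul, rid_tmul, map_smul,
              smul_eq_mul]
            ring
      have := h (comul a) (comul b)
      simpa [LinearMap.convMul_def, ← Bialgebra.comul_mul] using this
    simp only [Set.mem_ofPred_eq] at hx hy
    simp only [Ring.lie_def, WithConv.ofConv_sub, LinearMap.sub_apply, key hx hy, key hy hx]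
    ring

end Lie

/-- A representation of `G` on the `k`-vector space `V`, as a (right) comodule over `A = k[G]`:
an element `g ∈ G(R)` acts by `v ↦ ∑ v₀ ⊗ g(v₁)`, where `coact v = ∑ v₀ ⊗ v₁`. -/
structure GRep (k A V : Type*) [Field k] [CommRing A] [HopfAlgebra k A] [AddCommGroup V]
    [Module k V] where
  coact : V →ₗ[k] V ⊗[k] A
  coassoc : (TensorProduct.assoc k V A A).toLinearMap ∘ₗ coact.rTensor A ∘ₗ coact =
    (comul (R := k) (A := A)).lTensor V ∘ₗ coact
  counit_coact : (counit (R := k) (A := A)).lTensor V ∘ₗ coact = (TensorProduct.mk k V k).flip 1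

namespace GRep

variable {k A V W : Type*} [Field k] [CommRing A] [HopfAlgebra k A] [AddCommGroup V]
  [Module k V] [AddCommGroup W] [Module k W]

/-- A linear form on `A` acts on a comodule. -/
def act (ρ : GRep k A V) (x : A →ₗ[k] k) : V →ₗ[k] V :=
  (TensorProduct.rid k V).toLinearMap ∘ₗ x.lTensor V ∘ₗ ρ.coact

/-- The differential `dρ : 𝔤 → 𝔤𝔩(V)`. -/
def diff (ρ : GRep k A V) : Lie k A →ₗ⁅k⁆ Module.End k V where
  toFun x := ρ.act x.1.ofConv
  map_add' x y := by ext v; simp [act, LinearMap.lTensor_add]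
  map_smul' c x := by ext v; simp [act, LinearMap.lTensor_smul]
  map_lie' {x y} := by
    have key : ∀ x y : WithConv (A →ₗ[k] k),
        ρ.act (x * y).ofConv = ρ.act x.ofConv * ρ.act y.ofConv := by
      intro x y
      ext v
      have h₁ : ∀ t : V ⊗[k] A, TensorProduct.rid k V ((x * y).ofConv.lTensor V t) =
          TensorProduct.rid k V ((LinearMap.mul' k k ∘ₗ map x.ofConv y.ofConv).lTensor V
            ((comul (R := k) (A := A)).lTensor V t)) := by
        intro t
        induction t with
        | zero => simp
        | add t₁ t₂ h₁ h₂ => simp only [map_add, h₁, h₂]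
        | tmul v a => simp [LinearMap.convMul_def]
      have h₂ : ∀ t : (V ⊗[k] A) ⊗[k] A,
          TensorProduct.rid k V ((LinearMap.mul' k k ∘ₗ map x.ofConv y.ofConv).lTensor V
            (TensorProduct.assoc k V A A t)) =
          TensorProduct.rid k V (x.ofConv.lTensor V
            (TensorProduct.rid k (V ⊗[k] A) (y.ofConv.lTensor (V ⊗[k] A) t))) := by
        intro t
        induction t with
        | zero => simp
        | add t₁ t₂ h₁ h₂ => simp only [map_add, h₁, h₂]
        | tmul s a =>
          induction s with
          | zero => simp
          | add s₁ s₂ h₁ h₂ => simp only [add_tmul, map_add, h₁, h₂]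
          | tmul v b => simp [mul_smul, smul_comm (x.ofConv b)]
      have h₃ : ∀ t : V ⊗[k] A,
          TensorProduct.rid k (V ⊗[k] A) (y.ofConv.lTensor (V ⊗[k] A) (ρ.coact.rTensor A t)) =
          ρ.coact (TensorProduct.rid k V (y.ofConv.lTensor V t)) := by
        intro t
        induction t with
        | zero => simp
        | add t₁ t₂ h₁ h₂ => simp only [map_add, h₁, h₂]
        | tmul v a => simp
      have h₄ := LinearMap.congr_fun ρ.coassoc v
      simp only [LinearMap.comp_apply, LinearEquiv.coe_coe] at h₄
      simp only [act, Module.End.mul_apply, LinearMap.comp_apply, LinearEquiv.coe_coe]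
      rw [h₁, ← h₄, h₂, h₃]
    simp only [LieSubalgebra.coe_bracket, Ring.lie_def, ← key]
    ext v
    simp [act, LinearMap.lTensor_sub]

/-- The stabilizer `𝔤_v` of a vector. -/
def stabilizer (ρ : GRep k A V) (v : V) : Submodule k (Lie k A) where
  carrier := {x | ρ.diff x v = 0}
  zero_mem' := by simp
  add_mem' {x y} hx hy := by
    simp only [Set.mem_ofPred_eq] at hx hy ⊢
    simp [hx, hy]
  smul_mem' c x hx := by
    simp only [Set.mem_ofPred_eq] at hx ⊢
    simp [hx]

/-- The algebra of polynomial functions on `V`. -/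
def polyFun (k V : Type*) [Field k] [AddCommGroup V] [Module k V] : Subalgebra k (V → k) :=
  Algebra.adjoin k (Set.range fun (f : Module.Dual k V) (v : V) ↦ f v)

/-- `𝔤` acts virtually freely on `V`: for `v` in a dense Zariski-open subset of `V`, the stabilizer
`𝔤_v` is the kernel of `𝔤 → 𝔤𝔩(V)`. -/
def VirtuallyFree (ρ : GRep k A V) : Prop :=
  ∃ U : Set V, @IsOpen V (zariski (polyFun k V)) U ∧ @Dense V (zariski (polyFun k V)) U ∧
    ∀ v ∈ U, ρ.stabilizer v = LinearMap.ker ρ.diff.toLinearMap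

/-- `(V ⊗ A) ⊗ (W ⊗ A) → (V ⊗ W) ⊗ A`, `(v ⊗ a) ⊗ (w ⊗ b) ↦ (v ⊗ w) ⊗ a b`. -/
def mulMap (k A V W : Type*) [Field k] [CommRing A] [Algebra k A] [AddCommGroup V]
    [Module k V] [AddCommGroup W] [Module k W] :
    (V ⊗[k] A) ⊗[k] (W ⊗[k] A) →ₗ[k] (V ⊗[k] W) ⊗[k] A :=
  (LinearMap.mul' k A).lTensor (V ⊗[k] W) ∘ₗ
    (TensorProduct.tensorTensorTensorComm k V A W A).toLinearMap

@[simp] lemma mulMap_tmul (v : V) (a : A) (w : W) (b : A) :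
    mulMap k A V W ((v ⊗ₜ a) ⊗ₜ (w ⊗ₜ b)) = (v ⊗ₜ w) ⊗ₜ (a * b) := by
  simp [mulMap]

/-- The tensor product of two representations: `v ⊗ w ↦ ∑ (v₀ ⊗ w₀) ⊗ v₁ w₁`. -/
def tensor (ρ : GRep k A V) (σ : GRep k A W) : GRep k A (V ⊗[k] W) where
  coact := mulMap k A V W ∘ₗ TensorProduct.map ρ.coact σ.coact
  coassoc := by
    have h₁ : ∀ (x : V ⊗[k] A) (y : W ⊗[k] A),
        (mulMap k A V W ∘ₗ TensorProduct.map ρ.coact σ.coact).rTensor A (mulMap k A V W (x ⊗ₜ y)) =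
        (mulMap k A V W).rTensor A (mulMap k A (V ⊗[k] A) (W ⊗[k] A)
          (ρ.coact.rTensor A x ⊗ₜ σ.coact.rTensor A y)) := by
      intro x y
      induction x with
      | zero => simp
      | add x₁ x₂ h₁ h₂ => simp only [add_tmul, map_add, h₁, h₂]
      | tmul v a =>
        induction y with
        | zero => simp
        | add x₁ x₂ h₁ h₂ => simp only [tmul_add, map_add, h₁, h₂]
        | tmul w b => simp
    have h₂ : ∀ (x : (V ⊗[k] A) ⊗[k] A) (y : (W ⊗[k] A) ⊗[k] A),
        TensorProduct.assoc k (V ⊗[k] W) A A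
          ((mulMap k A V W).rTensor A (mulMap k A (V ⊗[k] A) (W ⊗[k] A) (x ⊗ₜ y))) =
        mulMap k (A ⊗[k] A) V W
          (TensorProduct.assoc k V A A x ⊗ₜ TensorProduct.assoc k W A A y) := by
      intro x y
      induction x with
      | zero => simp
      | add x₁ x₂ h₁ h₂ => simp only [add_tmul, map_add, h₁, h₂]
      | tmul x a =>
        induction x with
        | zero => simp
        | add x₁ x₂ h₁ h₂ => simp only [add_tmul, map_add, h₁, h₂]
        | tmul v a' =>
          induction y with
          | zero => simp
          | add x₁ x₂ h₁ h₂ => simp only [tmul_add, map_add, h₁, h₂]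
          | tmul y b =>
            induction y with
            | zero => simp
            | add x₁ x₂ h₁ h₂ => simp only [add_tmul, tmul_add, map_add, h₁, h₂]
            | tmul w b' => simp
    have h₃ : ∀ (x : V ⊗[k] A) (y : W ⊗[k] A),
        (comul (R := k) (A := A)).lTensor (V ⊗[k] W) (mulMap k A V W (x ⊗ₜ y)) =
        mulMap k (A ⊗[k] A) V W
          ((comul (R := k) (A := A)).lTensor V x ⊗ₜ (comul (R := k) (A := A)).lTensor W y) := by
      intro x y
      induction x with
      | zero => simp
      | add x₁ x₂ h₁ h₂ => simp only [add_tmul, map_add, h₁, h₂]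
      | tmul v a =>
        induction y with
        | zero => simp
        | add x₁ x₂ h₁ h₂ => simp only [tmul_add, map_add, h₁, h₂]
        | tmul w b => simp
    ext v w
    have hv := LinearMap.congr_fun ρ.coassoc v
    have hw := LinearMap.congr_fun σ.coassoc w
    simp only [LinearMap.comp_apply, LinearEquiv.coe_coe] at hv hw
    simp only [AlgebraTensorModule.curry_apply, curry_apply, LinearMap.coe_restrictScalars,
      LinearMap.comp_apply (f := mulMap k A V W), LinearMap.comp_apply, LinearEquiv.coe_coe,
      map_tmul]
    have h₁' := h₁ (ρ.coact v) (σ.coact w)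
    rw [h₁', h₂, h₃, hv, hw]
  counit_coact := by
    have h : ∀ (x : V ⊗[k] A) (y : W ⊗[k] A),
        (counit (R := k) (A := A)).lTensor (V ⊗[k] W) (mulMap k A V W (x ⊗ₜ y)) =
        mulMap k k V W
          ((counit (R := k) (A := A)).lTensor V x ⊗ₜ (counit (R := k) (A := A)).lTensor W y) := by
      intro x y
      induction x with
      | zero => simp
      | add x₁ x₂ h₁ h₂ => simp only [add_tmul, map_add, h₁, h₂]
      | tmul v a =>
        induction y with
        | zero => simp
        | add x₁ x₂ h₁ h₂ => simp only [tmul_add, map_add, h₁, h₂]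
        | tmul w b => simp
    ext v w
    have hv := LinearMap.congr_fun ρ.counit_coact v
    have hw := LinearMap.congr_fun σ.counit_coact w
    simp only [LinearMap.comp_apply] at hv hw
    simp [h, hv, hw]

/-- The antipode reverses the comultiplication. -/
lemma comul_antipode (a : A) : comul (R := k) (HopfAlgebra.antipode k a) =
    TensorProduct.comm k A A
      (map (HopfAlgebra.antipode k) (HopfAlgebra.antipode k) (comul (R := k) a)) := by
  let l : WithConv (A →ₐ[k] A ⊗[k] A) := .toConv Algebra.TensorProduct.includeLeft
  let r : WithConv (A →ₐ[k] A ⊗[k] A) := .toConv Algebra.TensorProduct.includeRight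
  have h : l * r = .toConv (Bialgebra.comulAlgHom k A) := by
    apply WithConv.ofConv_injective
    ext a
    change Algebra.TensorProduct.lmul' k (Algebra.TensorProduct.map l.ofConv r.ofConv
      (comul (R := k) a)) = comul (R := k) a
    generalize comul (R := k) a = t
    induction t with
    | zero => simp
    | add t₁ t₂ h₁ h₂ => simp only [map_add, h₁, h₂]
    | tmul a b => simp [l, r]
  have h' := mul_inv_rev l r
  rw [h] at h'
  have h'' : comul (R := k) (HopfAlgebra.antipode k a) =
      Algebra.TensorProduct.lmul' k (Algebra.TensorProduct.map (r⁻¹).ofConv (l⁻¹).ofConv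
        (comul (R := k) a)) := congr($(h').ofConv a)
  rw [h'']
  generalize comul (R := k) a = t
  induction t with
  | zero => simp
  | add t₁ t₂ h₁ h₂ => simp only [map_add, h₁, h₂]
  | tmul a b =>
    have hl : ∀ a, (l⁻¹).ofConv a = HopfAlgebra.antipode k a ⊗ₜ[k] 1 := fun a ↦ rfl
    have hr : ∀ a, (r⁻¹).ofConv a = 1 ⊗ₜ[k] HopfAlgebra.antipode k a := fun a ↦ rfl
    simp [hl, hr]

/-- The matrix coefficients `v ↦ ∑ f(v₀) S(v₁)`, i.e. `v ↦ (g ↦ f(g⁻¹ v))`, for `f ∈ V*`. -/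
def dualCoeff (ρ : GRep k A V) : Module.Dual k V →ₗ[k] V →ₗ[k] A where
  toFun f := HopfAlgebra.antipode k ∘ₗ (TensorProduct.lid k A).toLinearMap ∘ₗ
    LinearMap.rTensor A f ∘ₗ ρ.coact
  map_add' f g := by ext v; simp [LinearMap.rTensor_add]
  map_smul' c f := by ext v; simp [LinearMap.rTensor_smul]

/-- The dual representation on `V*`: `(g f)(v) = f(g⁻¹ v)`. The linear map
`dualCoeff f : V → A` is seen as an element of `V* ⊗ A`. -/
def dual [Module.Finite k V] (ρ : GRep k A V) : GRep k A (Module.Dual k V) where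
  coact := (dualTensorHomEquiv k V A).symm.toLinearMap ∘ₗ ρ.dualCoeff
  coassoc := by
    refine LinearMap.ext fun f ↦ (dualTensorHomEquiv k V (A ⊗[k] A)).injective ?_
    have h₁ : ∀ t : Module.Dual k V ⊗[k] A,
        dualTensorHomEquiv k V (A ⊗[k] A) ((comul (R := k) (A := A)).lTensor _ t) =
        comul (R := k) (A := A) ∘ₗ dualTensorHomEquiv k V A t := by
      intro t
      induction t with
      | zero => simp
      | add t₁ t₂ h₁ h₂ => simp only [map_add, h₁, h₂, LinearMap.comp_add]
      | tmul f a => ext v; simp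
    have h₂ : ∀ (t : Module.Dual k V ⊗[k] A) (a : A) (v : V),
        dualTensorHomEquiv k V (A ⊗[k] A) (TensorProduct.assoc k _ A A (t ⊗ₜ a)) v =
        dualTensorHomEquiv k V A t v ⊗ₜ a := by
      intro t a v
      induction t with
      | zero => simp
      | add t₁ t₂ h₁ h₂ => simp only [add_tmul, map_add, h₁, h₂, LinearMap.add_apply]
      | tmul f a => simp [smul_tmul']
    have h₃ : ∀ (f : Module.Dual k V) (a : A) (x : V ⊗[k] A),
        HopfAlgebra.antipode k (TensorProduct.lid k A (f.rTensor A x)) ⊗ₜ[k] a =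
        TensorProduct.comm k A A (map (dualTensorHomEquiv k V A (f ⊗ₜ a))
          (HopfAlgebra.antipode k) x) := by
      intro f a x
      induction x with
      | zero => simp
      | add t₁ t₂ h₁ h₂ => simp only [add_tmul, map_add, h₁, h₂]
      | tmul v b => simp [smul_tmul']
    have h₄ : ∀ (t : Module.Dual k V ⊗[k] A) (v : V),
        dualTensorHomEquiv k V (A ⊗[k] A) (TensorProduct.assoc k _ A A
          (((dualTensorHomEquiv k V A).symm.toLinearMap ∘ₗ ρ.dualCoeff).rTensor A t)) v =
        TensorProduct.comm k A A (map (dualTensorHomEquiv k V A t)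
          (HopfAlgebra.antipode k) (ρ.coact v)) := by
      intro t v
      induction t with
      | zero => simp
      | add t₁ t₂ h₁ h₂ =>
        simp only [map_add, h₁, h₂, LinearMap.add_apply, TensorProduct.map_add_left]
      | tmul f a =>
        rw [LinearMap.rTensor_tmul, h₂, ← h₃, LinearMap.comp_apply, LinearEquiv.coe_coe,
          LinearEquiv.apply_symm_apply]
        rfl
    have h₅ : ∀ x : (V ⊗[k] A) ⊗[k] A,
        TensorProduct.lid k (A ⊗[k] A) (f.rTensor (A ⊗[k] A) (TensorProduct.assoc k V A A x)) =
        ((TensorProduct.lid k A).toLinearMap ∘ₗ f.rTensor A).rTensor A x := by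
      intro x
      induction x with
      | zero => simp
      | add t₁ t₂ h₁ h₂ => simp only [map_add, h₁, h₂]
      | tmul x a =>
        induction x with
        | zero => simp
        | add t₁ t₂ h₁ h₂ => simp only [add_tmul, map_add, h₁, h₂]
        | tmul v b => simp [smul_tmul']
    have h₆ : ∀ x : V ⊗[k] A,
        TensorProduct.lid k (A ⊗[k] A) (f.rTensor (A ⊗[k] A)
          ((comul (R := k) (A := A)).lTensor V x)) =
        comul (R := k) (TensorProduct.lid k A (f.rTensor A x)) := by
      intro x
      induction x with
      | zero => simp
      | add t₁ t₂ h₁ h₂ => simp only [map_add, h₁, h₂]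
      | tmul v b => simp
    have h₇ : ∀ x : V ⊗[k] A,
        map (ρ.dualCoeff f) (HopfAlgebra.antipode k) x =
        map (HopfAlgebra.antipode k) (HopfAlgebra.antipode k)
          (((TensorProduct.lid k A).toLinearMap ∘ₗ f.rTensor A).rTensor A
            (ρ.coact.rTensor A x)) := by
      intro x
      induction x with
      | zero => simp
      | add t₁ t₂ h₁ h₂ => simp only [map_add, h₁, h₂]
      | tmul v b => simp [dualCoeff]
    ext v
    have hv := LinearMap.congr_fun ρ.coassoc v
    simp only [LinearMap.comp_apply, LinearEquiv.coe_coe] at hv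
    simp only [LinearMap.comp_apply (f := (comul (R := k) (A := A)).lTensor _),
      LinearMap.comp_apply (f := (TensorProduct.assoc k _ A A).toLinearMap),
      LinearMap.comp_apply (f := LinearMap.rTensor A _)]
    rw [LinearEquiv.coe_coe, h₁, h₄, LinearMap.comp_apply (f := (LinearEquiv.symm _).toLinearMap),
      LinearEquiv.coe_coe, LinearEquiv.apply_symm_apply, h₇, ← h₅, hv, h₆]
    exact (comul_antipode _).symm
  counit_coact := by
    refine LinearMap.ext fun f ↦ (dualTensorHomEquiv k V k).injective ?_
    have h₁ : ∀ t : Module.Dual k V ⊗[k] A,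
        dualTensorHomEquiv k V k ((counit (R := k) (A := A)).lTensor _ t) =
        counit (R := k) (A := A) ∘ₗ dualTensorHomEquiv k V A t := by
      intro t
      induction t with
      | zero => simp
      | add t₁ t₂ h₁ h₂ => simp only [map_add, h₁, h₂, LinearMap.comp_add]
      | tmul f a => ext v; simp
    have h₂ : ∀ x : V ⊗[k] A, counit (R := k) (TensorProduct.lid k A (f.rTensor A x)) =
        f (TensorProduct.rid k V ((counit (R := k) (A := A)).lTensor V x)) := by
      intro x
      induction x with
      | zero => simp
      | add t₁ t₂ h₁ h₂ => simp only [map_add, h₁, h₂]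
      | tmul v b => simp [mul_comm]
    ext v
    have hv := LinearMap.congr_fun ρ.counit_coact v
    simp only [LinearMap.comp_apply] at hv
    rw [LinearMap.comp_apply, h₁, LinearMap.comp_apply (f := (LinearEquiv.symm _).toLinearMap),
      LinearEquiv.coe_coe, LinearEquiv.apply_symm_apply]
    simp [dualCoeff, h₂, hv]

end GRep

/-- The `i`-th Frobenius twist of the vector space `V`: the same abelian group, on which `c ∈ k`
acts as `c ^ (p ^ (-i))` does on `V`. -/
@[nolint unusedArguments] def Twist (_k : Type*) (_p _i : ℕ) (V : Type*) : Type _ := V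

namespace Twist

variable {k : Type*} [Field k] {p : ℕ} [ExpChar k p] [PerfectRing k p] {i : ℕ} {V : Type*}
  [AddCommGroup V] [Module k V]

instance : AddCommGroup (Twist k p i V) := inferInstanceAs (AddCommGroup V)

instance : Module k (Twist k p i V) :=
  Module.compHom V (iterateFrobeniusEquiv k p i).symm.toRingHom

variable (k p i V) in
/-- The identity map `V → Twist k p i V`; it is semilinear for the `p ^ i`-th power map. -/
def of : V →ₛₗ[iterateFrobenius k p i] Twist k p i V where
  toFun v := v
  map_add' _ _ := rfl
  map_smul' c v := by
    change c • v = (iterateFrobeniusEquiv k p i).symm (iterateFrobenius k p i c) • v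
    rw [← coe_iterateFrobeniusEquiv, RingEquiv.symm_apply_apply]

variable (k p i V) in
/-- The identity map `Twist k p i V → V`. -/
def unof : Twist k p i V →+ V := AddMonoidHom.id V

lemma unof_smul (c : k) (v : Twist k p i V) :
    unof k p i V (c • v) = (iterateFrobeniusEquiv k p i).symm c • unof k p i V v := rfl

@[simp] lemma of_unof (v : Twist k p i V) : of k p i V (unof k p i V v) = v := rfl

@[simp] lemma unof_of (v : V) : unof k p i V (of k p i V v) = v := rfl

end Twist

/-- The `p ^ i`-th power map on a `k`-algebra. -/
def frobPow (k A : Type*) (p i : ℕ) [Field k] [ExpChar k p] [CommRing A] [HopfAlgebra k A] :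
    A →ₛₗ[iterateFrobenius k p i] A where
  toFun a := a ^ p ^ i
  map_add' a b := by
    have : Nontrivial A := (Bialgebra.counitAlgHom k A).toRingHom.domain_nontrivial
    have := expChar_of_injective_algebraMap (FaithfulSMul.algebraMap_injective k A) p
    exact add_pow_expChar_pow a b p i
  map_smul' c a := by simp [smul_pow, iterateFrobenius_def]

@[simp] lemma frobPow_apply {k A : Type*} {p i : ℕ} [Field k] [ExpChar k p] [CommRing A]
    [HopfAlgebra k A] (a : A) : frobPow k A p i a = a ^ p ^ i := rfl

/-- The coaction `v ↦ ∑ v₀ ⊗ v₁ ^ (p ^ i)` of the twisted representation. -/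
def GRep.twistCoact {k A V : Type*} [Field k] [CommRing A] [HopfAlgebra k A] [AddCommGroup V]
    [Module k V] (p i : ℕ) [ExpChar k p] [PerfectRing k p] (ρ : GRep k A V) :
    Twist k p i V →ₗ[k] Twist k p i V ⊗[k] A where
  toFun v := TensorProduct.map (Twist.of k p i V) (frobPow k A p i)
    (ρ.coact (Twist.unof k p i V v))
  map_add' v w := by simp only [map_add]
  map_smul' c v := by
    rw [Twist.unof_smul, map_smul, LinearMap.map_smulₛₗ, ← coe_iterateFrobeniusEquiv,
      RingEquiv.apply_symm_apply, RingHom.id_apply]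

/-- The `i`-th Frobenius twist of a representation: on the twisted vector space, the matrix
coefficients are raised to the power `p ^ i`, i.e. `v ↦ ∑ v₀ ⊗ v₁ ^ (p ^ i)`. -/
def GRep.twist {k A V : Type*} [Field k] [CommRing A] [HopfAlgebra k A] [AddCommGroup V]
    [Module k V] (p i : ℕ) [ExpChar k p] [PerfectRing k p] (ρ : GRep k A V) :
    GRep k A (Twist k p i V) where
  coact := ρ.twistCoact p i
  coassoc := by
    have h₁ : ∀ x : V ⊗[k] A, (ρ.twistCoact p i).rTensor A
        (TensorProduct.map (Twist.of k p i V) (frobPow k A p i) x) =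
        TensorProduct.map (TensorProduct.map (Twist.of k p i V) (frobPow k A p i))
          (frobPow k A p i) (ρ.coact.rTensor A x) := by
      intro x
      induction x with
      | zero => simp
      | add t₁ t₂ h₁ h₂ => simp only [map_add, h₁, h₂]
      | tmul v b => simp [twistCoact]
    have h₂ : ∀ x : (V ⊗[k] A) ⊗[k] A, TensorProduct.assoc k _ A A
        (TensorProduct.map (TensorProduct.map (Twist.of k p i V) (frobPow k A p i))
          (frobPow k A p i) x) =
        TensorProduct.map (Twist.of k p i V)
          (TensorProduct.map (frobPow k A p i) (frobPow k A p i))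
          (TensorProduct.assoc k V A A x) := by
      intro x
      induction x with
      | zero => simp
      | add t₁ t₂ h₁ h₂ => simp only [map_add, h₁, h₂]
      | tmul x b =>
        induction x with
        | zero => simp
        | add t₁ t₂ h₁ h₂ => simp only [add_tmul, map_add, h₁, h₂]
        | tmul v b => simp
    have h₃ : ∀ x : A ⊗[k] A, TensorProduct.map (frobPow k A p i) (frobPow k A p i) x =
        x ^ p ^ i := by
      have : Nontrivial A := (Bialgebra.counitAlgHom k A).toRingHom.domain_nontrivial
      have := expChar_of_injective_algebraMap (FaithfulSMul.algebraMap_injective k (A ⊗[k] A)) p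
      intro x
      induction x with
      | zero => simp [(expChar_pos k p).ne']
      | add t₁ t₂ h₁ h₂ => simp only [map_add, h₁, h₂, add_pow_expChar_pow]
      | tmul a b => simp [Algebra.TensorProduct.tmul_pow]
    have h₄ : ∀ x : V ⊗[k] A, (comul (R := k) (A := A)).lTensor _
        (TensorProduct.map (Twist.of k p i V) (frobPow k A p i) x) =
        TensorProduct.map (Twist.of k p i V)
          (TensorProduct.map (frobPow k A p i) (frobPow k A p i))
          ((comul (R := k) (A := A)).lTensor V x) := by
      intro x
      induction x with
      | zero => simp
      | add t₁ t₂ h₁ h₂ => simp only [map_add, h₁, h₂]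
      | tmul v b =>
        simp [h₃, Bialgebra.comul_pow]
    ext v
    have hv := LinearMap.congr_fun ρ.coassoc (Twist.unof k p i V v)
    simp only [LinearMap.comp_apply, LinearEquiv.coe_coe] at hv
    refine (congrArg (TensorProduct.assoc k _ A A) (h₁ _)).trans ?_
    rw [h₂, hv, ← h₄]
    rfl
  counit_coact := by
    have h : ∀ x : V ⊗[k] A, (counit (R := k) (A := A)).lTensor _
        (TensorProduct.map (Twist.of k p i V) (frobPow k A p i) x) =
        TensorProduct.map (Twist.of k p i V) (iterateFrobenius k p i).toSemilinearMap
          ((counit (R := k) (A := A)).lTensor V x) := by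
      intro x
      induction x with
      | zero => simp
      | add t₁ t₂ h₁ h₂ => simp only [map_add, h₁, h₂]
      | tmul v b => simp [iterateFrobenius_def, Bialgebra.counit_pow]
    ext v
    have hv := LinearMap.congr_fun ρ.counit_coact (Twist.unof k p i V v)
    simp only [LinearMap.comp_apply] at hv
    refine (h _).trans ?_
    rw [hv]
    simp

end AlgGrp

end

/-!
A point derivation kills `p`-th powers, so `𝔤` acts trivially on every Frobenius twist of positive
order (`GRep.diff_twist`). By the Leibniz rule (`GRep.diff_tensor`), `x ∈ 𝔤` therefore acts on
`W ⊗ W'`, where `W'` is the twist of `W` or of `W*`, as `x ⊗ 1`.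

As `dim W' = dim W`, a generic `v ∈ W ⊗ W'` is a tensor of full rank: the contraction
`W'* → W`, `f ↦ (1 ⊗ f) v`, is bijective. The contraction of `(x ⊗ 1) v` is `x` after the
contraction of `v`, so `(x ⊗ 1) v = 0` forces `x` to act as zero on `W`, hence on `W ⊗ W'`
(`GRep.virtuallyFree_tensor_of_diff_eq_zero`). Having full rank is the non-vanishing of a
determinant, a Zariski-open condition, and it is dense because a product of nonzero polynomial
functions on a vector space over an infinite field is nonzero (`exists_ne_zero_of_mem_polyFun`).
-/

namespace AlgGrp

open TensorProduct Coalgebra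

section Zariski

variable {k V : Type*} [Field k] [AddCommGroup V] [Module k V]

/-- A polynomial function restricts to a polynomial on each line. -/
lemma exists_polynomial_eval_line {f : V → k} (hf : f ∈ GRep.polyFun k V) (a b : V) :
    ∃ P : Polynomial k, ∀ t, f (a + t • b) = P.eval t := by
  induction hf using Algebra.adjoin_induction with
  | mem f hf =>
    obtain ⟨l, rfl⟩ := hf
    exact ⟨.C (l a) + .C (l b) * .X, fun t ↦ by simp [mul_comm t]⟩
  | algebraMap c => exact ⟨.C c, fun t ↦ by simp⟩
  | add f g _ _ hf hg =>
    obtain ⟨P, hP⟩ := hf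
    obtain ⟨Q, hQ⟩ := hg
    exact ⟨P + Q, fun t ↦ by simp [hP, hQ]⟩
  | mul f g _ _ hf hg =>
    obtain ⟨P, hP⟩ := hf
    obtain ⟨Q, hQ⟩ := hg
    exact ⟨P * Q, fun t ↦ by simp [hP, hQ]⟩

/-- Over an infinite field, the non-vanishing loci of two nonzero polynomial functions meet. -/
lemma exists_ne_zero_of_mem_polyFun [Infinite k] {f g : V → k} (hf : f ∈ GRep.polyFun k V)
    (hg : g ∈ GRep.polyFun k V) {a b : V} (ha : f a ≠ 0) (hb : g b ≠ 0) :
    ∃ v, f v ≠ 0 ∧ g v ≠ 0 := by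
  -- On the line through `a` and `b`, both functions are nonzero polynomials in one variable.
  obtain ⟨P, hP⟩ := exists_polynomial_eval_line hf a (b - a)
  obtain ⟨Q, hQ⟩ := exists_polynomial_eval_line hg a (b - a)
  have hP0 : P ≠ 0 := by
    rintro rfl
    exact ha (by simpa using hP 0)
  have hQ0 : Q ≠ 0 := by
    rintro rfl
    exact hb (by simpa using hQ 1)
  obtain ⟨t, ht⟩ : ∃ t, (P * Q).eval t ≠ 0 := by
    by_contra! h
    exact mul_ne_zero hP0 hQ0 (Polynomial.funext (by simpa using h))
  rw [Polynomial.eval_mul, ← hP, ← hQ] at ht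
  exact ⟨_, left_ne_zero_of_mul ht, right_ne_zero_of_mul ht⟩

lemma isTopologicalBasis_zariski {X : Type*} (F : Subalgebra k (X → k)) :
    @TopologicalSpace.IsTopologicalBasis X (zariski F) {U | ∃ f ∈ F, U = {x | f x ≠ 0}} := by
  let := zariski F
  refine ⟨?_, ?_, rfl⟩
  · rintro _ ⟨f, hf, rfl⟩ _ ⟨g, hg, rfl⟩ x ⟨hfx, hgx⟩
    exact ⟨_, ⟨f * g, F.mul_mem hf hg, rfl⟩, mul_ne_zero hfx hgx,
      fun y hy ↦ ⟨left_ne_zero_of_mul hy, right_ne_zero_of_mul hy⟩⟩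
  · exact Set.eq_univ_of_univ_subset
      (Set.subset_sUnion_of_mem ⟨1, F.one_mem, by ext; simp⟩)

lemma isOpen_zariski_ne_zero {X : Type*} {F : Subalgebra k (X → k)} {f : X → k} (hf : f ∈ F) :
    @IsOpen X (zariski F) {x | f x ≠ 0} :=
  @TopologicalSpace.IsTopologicalBasis.isOpen _ (zariski F) _ _
    (isTopologicalBasis_zariski F) ⟨f, hf, rfl⟩

lemma dense_zariski_ne_zero [Infinite k] {f : V → k} (hf : f ∈ GRep.polyFun k V) {a : V}
    (ha : f a ≠ 0) : @Dense V (zariski (GRep.polyFun k V)) {v | f v ≠ 0} := by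
  let := zariski (GRep.polyFun k V)
  rw [(isTopologicalBasis_zariski (GRep.polyFun k V)).dense_iff]
  rintro _ ⟨g, hg, rfl⟩ ⟨b, hb⟩
  obtain ⟨v, hfv, hgv⟩ := exists_ne_zero_of_mem_polyFun hf hg ha hb
  exact ⟨v, hgv, hfv⟩

lemma det_mem_polyFun {ι : Type*} [Fintype ι] [DecidableEq ι] (M : V →ₗ[k] Matrix ι ι k) :
    (fun v ↦ (M v).det) ∈ GRep.polyFun k V := by
  have h : (fun v ↦ (M v).det) =
      ∑ s : Equiv.Perm ι, Equiv.Perm.sign s • ∏ i, fun v ↦ M v (s i) i := by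
    ext v
    simp [Matrix.det_apply, Finset.sum_apply, Finset.prod_apply]
  rw [h]
  refine sum_mem fun s _ ↦ zsmul_mem (Subalgebra.prod_mem _ fun i _ ↦ ?_) _
  exact Algebra.subset_adjoin ⟨Matrix.entryLinearMap k k (s i) i ∘ₗ M, rfl⟩

end Zariski

section Contraction

variable {k V W : Type*} [Field k] [AddCommGroup V] [Module k V] [AddCommGroup W] [Module k W]

/-- The contraction `V ⊗ W → Hom(W*, V)`, `v ⊗ w ↦ (f ↦ f(w) v)`. -/
def contract (k V W : Type*) [Field k] [AddCommGroup V] [Module k V] [AddCommGroup W]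
    [Module k W] : V ⊗[k] W →ₗ[k] Module.Dual k W →ₗ[k] V :=
  TensorProduct.lift (LinearMap.smulRightₗ ∘ₗ Module.Dual.eval k W).flip

@[simp] lemma contract_tmul (v : V) (w : W) (f : Module.Dual k W) :
    contract k V W (v ⊗ₜ w) f = f w • v := by
  simp [contract]

lemma contract_rTensor (T : Module.End k V) (u : V ⊗[k] W) :
    contract k V W (T.rTensor W u) = T ∘ₗ contract k V W u := by
  induction u with
  | zero => simp
  | add u₁ u₂ h₁ h₂ => simp only [map_add, h₁, h₂, LinearMap.comp_add]
  | tmul v w => ext f; simp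

end Contraction

namespace Twist

variable {k : Type*} [Field k] {p : ℕ} [ExpChar k p] [PerfectRing k p] {i : ℕ} {V : Type*}
  [AddCommGroup V] [Module k V]

lemma finrank_eq : Module.finrank k (Twist k p i V) = Module.finrank k V := by
  have h := rank_eq_of_equiv_equiv (iterateFrobeniusEquiv k p i)
    (show V ≃+ Twist k p i V from AddEquiv.refl V) (iterateFrobeniusEquiv k p i).bijective
    fun c v ↦ (of k p i V).map_smulₛₗ c v
  exact congr(Cardinal.toNat $h.symm)

instance [Module.Finite k V] : Module.Finite k (Twist k p i V) :=
  have : RingHomSurjective (iterateFrobenius k p i) :=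
    ⟨(iterateFrobeniusEquiv k p i).surjective⟩
  .of_surjective (of k p i V) fun v ↦ ⟨unof k p i V v, rfl⟩

end Twist

section Lie

variable {k A : Type*} [Field k] [CommRing A] [HopfAlgebra k A]

lemma Lie.apply_mul (x : Lie k A) (a b : A) : x.1.ofConv (a * b) =
    counit (R := k) a * x.1.ofConv b + counit (R := k) b * x.1.ofConv a :=
  x.2 a b

lemma Lie.apply_pow_succ (x : Lie k A) (a : A) (n : ℕ) : x.1.ofConv (a ^ (n + 1)) =
    (n + 1) * counit (R := k) a ^ n * x.1.ofConv a := by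
  induction n with
  | zero => simp
  | succ n ih =>
    rw [pow_succ, Lie.apply_mul, ih, Bialgebra.counit_pow]
    push_cast
    ring

lemma Lie.apply_pow_char_pow {p : ℕ} [Fact p.Prime] [CharP k p] (x : Lie k A) (a : A) {i : ℕ}
    (hi : 0 < i) : x.1.ofConv (a ^ p ^ i) = 0 := by
  obtain ⟨n, hn⟩ : ∃ n, p ^ i = n + 1 :=
    Nat.exists_eq_succ_of_ne_zero (pow_ne_zero i (Fact.out : p.Prime).ne_zero)
  have h : ((n : k) + 1) = 0 := by
    have := congr((($hn : ℕ) : k))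
    simpa [hi.ne'] using this.symm
  rw [hn, Lie.apply_pow_succ, h, zero_mul, zero_mul]

end Lie

namespace GRep

variable {k A V W : Type*} [Field k] [CommRing A] [HopfAlgebra k A] [AddCommGroup V]
  [Module k V] [AddCommGroup W] [Module k W]

lemma diff_apply (ρ : GRep k A V) (x : Lie k A) (v : V) :
    ρ.diff x v = TensorProduct.rid k V (x.1.ofConv.lTensor V (ρ.coact v)) := rfl

/-- The Leibniz rule for the action of `𝔤` on a tensor product. -/
lemma diff_tensor (ρ : GRep k A V) (σ : GRep k A W) (x : Lie k A) :
    (ρ.tensor σ).diff x = (ρ.diff x).rTensor W + (σ.diff x).lTensor V := by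
  have key : ∀ (s : V ⊗[k] A) (t : W ⊗[k] A),
      TensorProduct.rid k _ (x.1.ofConv.lTensor (V ⊗[k] W) (mulMap k A V W (s ⊗ₜ t))) =
      TensorProduct.rid k V (x.1.ofConv.lTensor V s) ⊗ₜ
          TensorProduct.rid k W ((counit (R := k) (A := A)).lTensor W t) +
        TensorProduct.rid k V ((counit (R := k) (A := A)).lTensor V s) ⊗ₜ
          TensorProduct.rid k W (x.1.ofConv.lTensor W t) := by
    intro s t
    induction s with
    | zero => simp
    | add s₁ s₂ h₁ h₂ => simp only [add_tmul, map_add, h₁, h₂]; abel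
    | tmul v a =>
      induction t with
      | zero => simp
      | add t₁ t₂ h₁ h₂ => simp only [tmul_add, map_add, h₁, h₂]; abel
      | tmul w b =>
        simp only [mulMap_tmul, LinearMap.lTensor_tmul, rid_tmul, Lie.apply_mul,
          smul_tmul_smul, add_smul]
        rw [add_comm, mul_comm]
  ext v w
  have hv := LinearMap.congr_fun ρ.counit_coact v
  have hw := LinearMap.congr_fun σ.counit_coact w
  simp only [LinearMap.comp_apply] at hv hw
  refine (key (ρ.coact v) (σ.coact w)).trans ?_
  simp [hv, hw, diff_apply]

/-- The Lie algebra acts trivially on Frobenius twists. -/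
lemma diff_twist {p : ℕ} [Fact p.Prime] [CharP k p] [PerfectRing k p] (ρ : GRep k A V) {i : ℕ}
    (hi : 0 < i) (x : Lie k A) : (ρ.twist p i).diff x = 0 := by
  have key : ∀ t : V ⊗[k] A, x.1.ofConv.lTensor _
      (TensorProduct.map (Twist.of k p i V) (frobPow k A p i) t) = 0 := by
    intro t
    induction t with
    | zero => simp
    | add t₁ t₂ h₁ h₂ => simp only [map_add, h₁, h₂, add_zero]
    | tmul v a => simp [Lie.apply_pow_char_pow x a hi]
  ext v
  refine (congrArg (TensorProduct.rid k _) (key _)).trans ?_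
  simp

/-- If `𝔤` acts trivially on `W` and `dim W = dim V`, then `V ⊗ W` is, for `𝔤`, a sum of `dim V`
copies of `V`, and a tensor of full rank is killed only by the kernel of the action on `V`. -/
theorem virtuallyFree_tensor_of_diff_eq_zero [Infinite k] [Module.Finite k V] [Module.Finite k W]
    (ρ : GRep k A V) (σ : GRep k A W) (hσ : ∀ x, σ.diff x = 0)
    (h : Module.finrank k W = Module.finrank k V) : (ρ.tensor σ).VirtuallyFree := by
  have hdiff : ∀ x, (ρ.tensor σ).diff x = (ρ.diff x).rTensor W := fun x ↦ by
    rw [diff_tensor, hσ, LinearMap.lTensor_zero, add_zero]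
  let b := Module.finBasis k V
  let c := Module.finBasisOfFinrankEq k W h
  let M : V ⊗[k] W →ₗ[k] Matrix (Fin (Module.finrank k V)) (Fin (Module.finrank k V)) k :=
    (LinearMap.toMatrix c.dualBasis b).toLinearMap ∘ₗ contract k V W
  have hM : ∀ u, M u = LinearMap.toMatrix c.dualBasis b (contract k V W u) := fun _ ↦ rfl
  have hpoly := det_mem_polyFun M
  have hone : (M (∑ i, b i ⊗ₜ c i)).det ≠ 0 := by
    have : M (∑ i, b i ⊗ₜ c i) = 1 := by
      ext i j
      simp [hM, LinearMap.toMatrix_apply, Matrix.one_apply, LinearMap.sum_apply,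
        Finsupp.single_apply, eq_comm]
    simp [this]
  refine ⟨{u | (M u).det ≠ 0}, isOpen_zariski_ne_zero hpoly, dense_zariski_ne_zero hpoly hone,
    fun u hu ↦ le_antisymm (fun x hx ↦ ?_) fun x hx ↦ ?_⟩
  · have hsurj : Function.Surjective (contract k V W u) :=
      (LinearEquiv.ofIsUnitDet (f := contract k V W u) (v := c.dualBasis) (v' := b)
        (isUnit_iff_ne_zero.mpr hu)).surjective
    have hx' : (ρ.diff x).rTensor W u = 0 := by
      rw [← hdiff]
      exact hx
    have hcomp : ρ.diff x ∘ₗ contract k V W u = 0 := by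
      rw [← contract_rTensor, hx', map_zero]
    have hzero : ρ.diff x = 0 := by
      ext v
      obtain ⟨f, rfl⟩ := hsurj v
      exact LinearMap.congr_fun hcomp f
    change (ρ.tensor σ).diff x = 0
    rw [hdiff, hzero, LinearMap.rTensor_zero]
  · exact LinearMap.congr_fun (show (ρ.tensor σ).diff x = 0 from hx) u

end GRep

end AlgGrp

theorem mainTheorem8 {k : Type*} [Field k] [IsAlgClosed k] (p : ℕ) [Fact p.Prime] [CharP k p]
    {A : Type*} [CommRing A] [HopfAlgebra k A] (hG : AlgGrp.IsSemisimple k A)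
    {W : Type*} [AddCommGroup W] [Module k W] [Module.Finite k W] (ρ : AlgGrp.GRep k A W)
    (i : ℕ) (hi : 0 < i) :
    (ρ.tensor (ρ.twist p i)).VirtuallyFree ∧ (ρ.tensor (ρ.dual.twist p i)).VirtuallyFree := by
  have : Infinite k := IsAlgClosed.instInfinite
  exact ⟨ρ.virtuallyFree_tensor_of_diff_eq_zero _ (ρ.diff_twist hi) AlgGrp.Twist.finrank_eq,
    ρ.virtuallyFree_tensor_of_diff_eq_zero _ (ρ.dual.diff_twist hi)
      (AlgGrp.Twist.finrank_eq.trans Subspace.dual_finrank_eq)⟩
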